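/- Let $q$ be a finite directed query graph with $n$ vertices, each incident to at least one edge, and let $g$ be a finite directed data graph; vertices and edges of both carry sets of labels. A data edge $(v,v')$ matches a query edge $e=(u,u')$ if $L(u)\subseteq L(v)$, $L(u')\subseteq L(v')$, $L(e)\subseteq L(v,v')$, and $v=v'$ in case $u=u'$; let $R_e$ be the set of data edges that match $e$. Let $N_e\ge 1$ be integers with $|R_e|\le N_e$ for every $e\in E_q$ (for instance $N_e=|R_e|$ if no $R_e$ is empty), and let $$AGM(q)=\inf_x\ \prod_{e\in E_q}N_e^{x_e},$$ where $x$ ranges over the fractional edge covers of $q$, that is, over all $x\in[0,\infty)^{E_q}$ with $\sum_{e\ni u}x_e\ge 1$ for every $u\in V_q$. Let $o_1,\dots,o_n$ be any ordering of $V_q$ and let $0<b\le 1$. For a partial mapping $p$ that maps $o_1,\dots,o_{i-1}$ to data vertices, let $P_{o_i}$ be the intersection, over all query edges $e$ incident to $o_i$, of the following sets, where $o_k$ is the other endpoint of $e$: if $k<i$, the set of data vertices joined to $p(o_k)$ by a data edge that matches $e$; if $k\geq i$, the set of data vertices that are the $o_i$-endpoint of some data edge that matches $e$. Put $a_i=|P_{o_i}|$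 and $t_i=\lceil b\,a_i\rceil$, and define the random variable $$Y_n|p=a_n,\qquad Y_i|p=\frac{a_i}{t_i}\sum_{k=1}^{t_i}Y_{i+1}\,\big|\,p\cup\{o_i\mapsto v_k\}\quad(i<n),$$ where $v_1,\dots,v_{t_i}$ are drawn uniformly without replacement from $P_{o_i}$ and the summands are conditionally independent given the draws ($Y_i|p=0$ if $a_i=0$). Let $Y_1$ be $Y_1|\varnothing$. Consider the randomized recursive algorithm (Alley's random walk with intersection and branching) that, for a current $p$, computes $P_{o_i}$ by scanning a smallest one of the sets above and testing each of its elements for membership in all of them, returns $a_i$ if $i=n$ and $0$ if $a_i=0$, and otherwise draws $t_i$ elements $v$ of $P_{o_i}$ without replacement, calls itself on $p\cup\{o_i\mapsto v\}$ for each of them, and returns $a_i/t_i$ times the sum of the results. Steps are counted on a unit-cost random access machine with real arithmetic, a generator of uniform random indices, and an index of the data graph that finds each set above, reads its size or one of its entries, or tests membership in it in one step. Then there is a constant $C$ that depends only on $n$ such that, for all such $q$, $g$, $N$, orderings and $b$, one full run of the algorithm outputs a realization of $Y_1$ (its output has the law of $Y_1$), and takes at most $C\cdot AGM(q)$ steps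 whatever the random choices. -/

import Mathlib

noncomputable section

namespace Alley

open scoped Classical

/-! ### Labelled graphs, matching relations, the AGM bound -/

/-- A finite directed graph on the vertex type `V`; every vertex and every edge carries a set of
labels. An undirected data graph is the case of a symmetric edge set. -/
structure LGraph (V LV LE : Type) where
  edges : Finset (V × V)
  vlabel : V → Set LV
  elabel : V × V → Set LE

variable {VQ V LV LE : Type}

/-- The vertex `u` is an endpoint of the edge `e`. -/
def Incident (u : VQ) (e : VQ × VQ) : Prop := u = e.1 ∨ u = e.2

/-- The relation of the query edge `e`: all data edges that match `e`. -/
def rel (q : LGraph VQ LV LE) (g : LGraph V LV LE) (e : VQ × VQ) : Finset (V × V) :=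
  g.edges.filter fun d =>
    q.vlabel e.1 ⊆ g.vlabel d.1 ∧ q.vlabel e.2 ⊆ g.vlabel d.2 ∧ q.elabel e ⊆ g.elabel d ∧
      (e.1 = e.2 → d.1 = d.2)

/-- `x` is a fractional edge cover of the query graph `q`. -/
def IsFracEdgeCover (q : LGraph VQ LV LE) (x : VQ × VQ → ℝ) : Prop :=
  (∀ e ∈ q.edges, 0 ≤ x e) ∧ ∀ u : VQ, 1 ≤ ∑ e ∈ q.edges.filter (Incident u), x e

/-- The Atserias–Grohe–Marx bound of `q` for relations of sizes `N e`: the minimum of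
`∏ e, N e ^ x e` over the fractional edge covers `x`. -/
def agm (q : LGraph VQ LV LE) (N : VQ × VQ → ℕ) : ℝ :=
  sInf {r | ∃ x, IsFracEdgeCover q x ∧ r = ∏ e ∈ q.edges, (N e : ℝ) ^ x e}

/-! ### The random variable `Y₁` -/

/-- The data vertices that the query edge `e` admits for its endpoint `u`, given the partial mapping
`p`. For an edge between `u` (unmapped) and `w`: if `p` maps `w` to `v`, these are the neighbours of
`v` along data edges that match `e` (the adjacency list `adj_w^u(v)`); if `w` is unmapped, they are
the data vertices with an incident data edge that matches `e` (the list `V_w^u`). -/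
def cand (q : LGraph VQ LV LE) (g : LGraph V LV LE) (p : VQ → Option V) (u : VQ) (e : VQ × VQ) :
    Finset V :=
  ((rel q g e).filter fun d =>
    (∀ v, p e.1 = some v → d.1 = v) ∧ (∀ v, p e.2 = some v → d.2 = v)).image
      fun d => if u = e.1 then d.1 else d.2

/-- The local sample space `P_u`: the intersection of the candidate sets of `u` over all query edges
incident to `u`. -/
def sampleSpace [Fintype V] (q : LGraph VQ LV LE) (g : LGraph V LV LE) (p : VQ → Option V)
    (u : VQ) : Finset V :=
  Finset.univ.filter fun v => ∀ e ∈ q.edges, Incident u e → v ∈ cand q g p u e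

/-- The branch size `⌈b · a⌉`. -/
def branchSize (b : ℝ) (a : ℕ) : ℕ := ⌈b * (a : ℝ)⌉₊

/-- The law of `Y v₁ + ⋯ + Y vₜ`, where `v₁, …, vₜ` are drawn uniformly without replacement from `P`
and, given the draws, the summands are independent. -/
def drawSum (Y : V → PMF ℝ) : ℕ → Finset V → PMF ℝ
  | 0, _ => PMF.pure 0
  | t + 1, P =>
    if h : P.Nonempty then
      (PMF.uniformOfFinset P h).bind fun v =>
        (Y v).bind fun y => (drawSum Y t (P.erase v)).map fun s => y + s
    else PMF.pure 0

/-- The law of `Y_i | p_i`, where the list holds the query vertices `o_i, …, o_n` that are still to be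
mapped: `Y_n = a_n`, and `Y_i = a_i · (1 / t_i) · ∑ₖ Y_{i+1}^k` for `i < n`, with `a_i` the size of the
local sample space and `t_i = ⌈b · a_i⌉`. (If `a_i = 0` the value is `0`; the empty list occurs only
for the empty query.) -/
def lawY [Fintype V] (b : ℝ) (q : LGraph VQ LV LE) (g : LGraph V LV LE) :
    List VQ → (VQ → Option V) → PMF ℝ
  | [], _ => PMF.pure 1
  | [u], p => PMF.pure ((sampleSpace q g p u).card : ℝ)
  | u :: u' :: us, p =>
    let P := sampleSpace q g p u
    let t := branchSize b P.card
    (drawSum (fun v => lawY b q g (u' :: us) (Function.update p u (some v))) t P).map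
      fun s => (P.card : ℝ) * (1 / (t : ℝ)) * s

/-- The law of `Y₁` for the matching order `o`. -/
def lawY₁ [Fintype V] (b : ℝ) (q : LGraph VQ LV LE) (g : LGraph V LV LE) (o : List VQ) : PMF ℝ :=
  lawY b q g o fun _ => none

/-! ### Randomized computations with a step count -/

/-- A randomized computation: the joint law of its result and of the number of elementary steps. -/
structure Timed (α : Type) : Type where
  joint : PMF (α × ℕ)

/-- Sequential composition adds up the steps; returning a value that is already at hand is free. -/
instance : Monad Timed where
  pure a := ⟨PMF.pure (a, 0)⟩
  bind m f := ⟨m.joint.bind fun r => (f r.1).joint.map fun s => (s.1, r.2 + s.2)⟩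

/-- One elementary operation, with result `a`; it takes one step. Below it is applied only to
operations of a unit-cost random access machine: arithmetic and comparison of two numbers, reading
or writing one cell of an array, reading the length of an array, and the index operations
described at `Indexed`. -/
def op {α : Type} (a : α) : Timed α := ⟨PMF.pure (a, 1)⟩

/-- One elementary operation: draw a uniform random index of an array of length `k + 1`. -/
def randIdx (k : ℕ) : Timed (Fin (k + 1)) :=
  ⟨(PMF.uniformOfFintype (Fin (k + 1))).map fun i => (i, 1)⟩

/-- The law of the result of a computation. -/
def Timed.law {α : Type} (m : Timed α) : PMF α := m.joint.map Prod.fst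

/-- Whatever the random choices, the computation takes at most `K` steps. -/
def Timed.StepsLE {α : Type} (m : Timed α) (K : ℝ) : Prop :=
  ∀ r ∈ m.joint.support, (r.2 : ℝ) ≤ K

/-! ### The algorithm

The data graph is stored with the usual index: for every query edge `e` and endpoint `u` of `e`, the
candidate set `cand q g p u e` (which depends on `p` only through the image of the other endpoint) is
stored as an array together with a hash set. Finding it, reading its length, reading one of its
entries, and testing one vertex for membership each take one step. -/

/-- An indexed set: a list without repetitions, with unit-time length, reading and membership. -/
abbrev Indexed (V : Type) : Type := List V

/-- Run through the query edges, and look up the candidate set of `u` for each one incident to `u`. -/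
def lookups (q : LGraph VQ LV LE) (g : LGraph V LV LE) (p : VQ → Option V) (u : VQ) :
    List (VQ × VQ) → Timed (List (Indexed V))
  | [] => pure []
  | e :: es => do
    let e ← op e
    let c ← op (decide (Incident u e))
    let rest ← lookups q g p u es
    if c then do
      let A ← op (cand q g p u e).toList
      op (A :: rest)
    else pure rest

/-- The shortest among `best` and the given indexed sets. -/
def shortest (best : Indexed V) : List (Indexed V) → Timed (Indexed V)
  | [] => pure best
  | A :: As => do
    let k ← op A.length
    let l ← op best.length
    let c ← op (decide (k < l))
    shortest (if c then A else best) As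

/-- Is `v` a member of all the given indexed sets? -/
def inAll (v : V) : List (Indexed V) → Timed Bool
  | [] => pure true
  | A :: As => do
    let c ← op (decide (v ∈ A))
    if c then inAll v As else pure false

/-- Read the entries of an array one by one, and collect those that lie in all the sets `As`. -/
def scan (As : List (Indexed V)) : List V → Timed (List V)
  | [] => pure []
  | v :: vs => do
    let v ← op v
    let c ← inAll v As
    let rest ← scan As vs
    if c then op (v :: rest) else pure rest

/-- Compute the local sample space of `u` as an array: intersect the candidate sets of `u` by scanning
a shortest one. -/
def intersect (q : LGraph VQ LV LE) (g : LGraph V LV LE) (p : VQ → Option V) (u : VQ) :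
    Timed (List V) := do
  let As ← lookups q g p u q.edges.toList
  match As with
  | [] => pure []
  | A :: As' => do
    let B ← shortest A As'
    scan (A :: As') B

/-- The sampling loop: `t` times, draw a random entry of the array, remove it from the array (overwrite
it by the last entry, then shorten the array by one), run `walk` on it, and add the result to `w`. -/
def sampleLoop (walk : V → Timed ℝ) : ℕ → List V → ℝ → Timed ℝ
  | 0, _, w => pure w
  | _ + 1, [], w => pure w
  | t + 1, v :: vs, w => do
    let _ ← op (v :: vs).length
    let i ← randIdx vs.length
    let x ← op ((v :: vs).get i)
    let last ← op ((v :: vs).getLast (List.cons_ne_nil v vs))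
    let pool ← op ((v :: vs).set i last)
    let pool ← op pool.dropLast
    let y ← walk x
    let w ← op (w + y)
    let _ ← op t
    sampleLoop walk t pool w

/-- The recursive random walk with intersection and branching; the list holds the query vertices
that are still to be mapped. -/
def walk (b : ℝ) (q : LGraph VQ LV LE) (g : LGraph V LV LE) :
    List VQ → (VQ → Option V) → Timed ℝ
  | [], _ => op 1
  | [u], p => do
    let u ← op u
    let P ← intersect q g p u
    let a ← op P.length
    op (a : ℝ)
  | u :: u' :: us, p => do
    let u ← op u
    let P ← intersect q g p u
    let a ← op P.length
    let z ← op (decide (a = 0))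
    if z then op 0
    else do
      let ba ← op (b * (a : ℝ))
      let t ← op ⌈ba⌉₊
      let w ← sampleLoop (fun v => do
        let p' ← op (Function.update p u (some v))
        walk b q g (u' :: us) p') t P 0
      let r ← op (1 / (t : ℝ))
      let s ← op ((a : ℝ) * r)
      op (s * w)

/-- One full run of the algorithm for the matching order `o`: initialize the partial mapping (one
step per query vertex) and start the walk. -/
def run (b : ℝ) (q : LGraph VQ LV LE) (g : LGraph V LV LE) (o : List VQ) : Timed ℝ := do
  let p ← o.foldlM (fun (p : VQ → Option V) u => op (Function.update p u none)) (fun _ => none)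
  walk b q g o p

end Alley

end

noncomputable section

namespace Alley

open scoped Classical

variable {VQ V LV LE α β : Type}

/-! Fix a fractional edge cover `x` and give each partial mapping `p` the weight W(p) = ∏ max(1,
|S_e(p)|)^(x e), where S_e(p) is the set of matching data edges for `e` that agree with `p`. Two
estimates carry the bound. The smallest candidate set at `u` has at most W(p) elements
(`le_potential`), so the work done locally at `p` is O(W(p)) with a constant depending on the query
size only. The weights of all extensions of `p` by a value from the sample space of `u` sum to at
most W(p), by Hölder's inequality (`sum_potential_le`). Sampling without replacement visits each
extension at most once, so each level of the recursion costs O(W(∅)), whatever `b` and the draws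
are. Finally W(∅) is at most the product defining `agm` for `x` (`potential_none_le`), and `x` was
arbitrary.

The law of the output follows the structure of the program. `Performs` carries law and step bound
through the same induction (`performs_walk`); the one real point is that overwriting and shortening
an array realizes a draw without replacement (`performs_sampleLoop`). -/

/-! ### A calculus of laws and step bounds -/

/-- The computation `m` is deterministic, returns `a`, and takes at most `K` steps. -/
def Yields (m : Timed α) (a : α) (K : ℕ) : Prop :=
  ∃ k ≤ K, m.joint = PMF.pure (a, k)

/-- The result of `m` has the law `μ`, and `m` takes at most `K` steps. -/
def Performs (m : Timed α) (μ : PMF α) (K : ℝ) : Prop :=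
  m.law = μ ∧ m.StepsLE K

theorem joint_bind (m : Timed α) (f : α → Timed β) :
    (m >>= f).joint =
      m.joint.bind fun r => (f r.1).joint.map fun s => (s.1, r.2 + s.2) := rfl

theorem yields_pure (a : α) (K : ℕ) : Yields (pure a) a K := ⟨0, Nat.zero_le _, rfl⟩

theorem yields_op (a : α) : Yields (op a) a 1 := ⟨1, le_rfl, rfl⟩

theorem Yields.mono {m : Timed α} {a : α} {K L : ℕ} (h : Yields m a K) (hKL : K ≤ L) :
    Yields m a L := by
  obtain ⟨k, hk, e⟩ := h
  exact ⟨k, hk.trans hKL, e⟩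

theorem Yields.bind {m : Timed α} {a : α} {K : ℕ} {f : α → Timed β} {c : β} {L : ℕ}
    (hm : Yields m a K) (hf : Yields (f a) c L) : Yields (m >>= f) c (K + L) := by
  obtain ⟨k, hk, e⟩ := hm
  obtain ⟨l, hl, e'⟩ := hf
  refine ⟨k + l, by omega, ?_⟩
  rw [joint_bind, e, PMF.pure_bind, e', PMF.pure_map]

theorem law_bind (m : Timed α) (f : α → Timed β) :
    (m >>= f).law = m.law.bind fun a => (f a).law := by
  simp only [Timed.law, joint_bind, PMF.map_bind, PMF.bind_map, PMF.map_comp]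
  rfl

theorem Timed.StepsLE.mono {m : Timed α} {K L : ℝ} (h : m.StepsLE K) (hKL : K ≤ L) :
    m.StepsLE L :=
  fun r hr => (h r hr).trans hKL

theorem Timed.StepsLE.bind {m : Timed α} {f : α → Timed β} {K L : ℝ} (hm : m.StepsLE K)
    (hf : ∀ a, (f a).StepsLE L) : (m >>= f).StepsLE (K + L) := by
  intro r hr
  rw [joint_bind, PMF.mem_support_bind_iff] at hr
  obtain ⟨s, hs, hr⟩ := hr
  rw [PMF.mem_support_map_iff] at hr
  obtain ⟨t, ht, rfl⟩ := hr
  push_cast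
  exact add_le_add (hm s hs) (hf _ t ht)

theorem Performs.mono {m : Timed α} {μ : PMF α} {K L : ℝ} (h : Performs m μ K) (hKL : K ≤ L) :
    Performs m μ L :=
  ⟨h.1, h.2.mono hKL⟩

/-- The bound `L` must serve every intermediate value, hence every random outcome;
`Yields.bind_performs` only asks for a bound at the one deterministic value. -/
theorem Performs.bind {m : Timed α} {f : α → Timed β} {μ : PMF α} {ν : α → PMF β} {K L : ℝ}
    (hm : Performs m μ K) (hf : ∀ a, Performs (f a) (ν a) L) :
    Performs (m >>= f) (μ.bind ν) (K + L) := by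
  refine ⟨?_, hm.2.bind fun a => (hf a).2⟩
  rw [law_bind, hm.1]
  congr 1
  funext a
  exact (hf a).1

theorem Yields.performs {m : Timed α} {a : α} {K : ℕ} (h : Yields m a K) :
    Performs m (PMF.pure a) K := by
  obtain ⟨k, hk, e⟩ := h
  constructor
  · rw [Timed.law, e, PMF.pure_map]
  · intro r hr
    rw [e, PMF.support_pure, Set.mem_singleton_iff] at hr
    subst hr
    exact_mod_cast hk

theorem Yields.bind_performs {m : Timed α} {a : α} {K : ℕ} {f : α → Timed β} {μ : PMF β} {L : ℝ}
    (hm : Yields m a K) (hf : Performs (f a) μ L) : Performs (m >>= f) μ (K + L) := by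
  obtain ⟨k, hk, e⟩ := hm
  constructor
  · rw [law_bind, Timed.law, e, PMF.pure_map, PMF.pure_bind]
    exact hf.1
  · intro r hr
    rw [joint_bind, e, PMF.pure_bind, PMF.mem_support_map_iff] at hr
    obtain ⟨s, hs, rfl⟩ := hr
    push_cast
    exact add_le_add (by exact_mod_cast hk) (hf.2 s hs)

theorem Performs.op_bind {a : α} {f : α → Timed β} {μ : PMF β} {L : ℝ}
    (hf : Performs (f a) μ L) : Performs (op a >>= f) μ (1 + L) := by
  simpa using (yields_op a).bind_performs hf

theorem performs_op (a : α) : Performs (op a) (PMF.pure a) 1 := by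
  simpa using (yields_op a).performs

theorem performs_randIdx (k : ℕ) :
    Performs (randIdx k) (PMF.uniformOfFintype (Fin (k + 1))) 1 := by
  constructor
  · rw [Timed.law, randIdx, PMF.map_comp]
    exact PMF.map_id _
  · intro r hr
    rw [randIdx, PMF.mem_support_map_iff] at hr
    obtain ⟨i, -, rfl⟩ := hr
    simp

/-! ### Intersecting the candidate sets -/

/-- The candidate sets of `u` over the query edges in the list that are incident to `u`. -/
def candLists (q : LGraph VQ LV LE) (g : LGraph V LV LE) (p : VQ → Option V) (u : VQ)
    (es : List (VQ × VQ)) : List (List V) :=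
  (es.filter fun e => decide (Incident u e)).map fun e => (cand q g p u e).toList

theorem yields_lookups (q : LGraph VQ LV LE) (g : LGraph V LV LE) (p : VQ → Option V) (u : VQ)
    (es : List (VQ × VQ)) :
    Yields (lookups q g p u es) (candLists q g p u es) (4 * es.length) := by
  induction es with
  | nil => exact yields_pure _ _
  | cons e es ih =>
    rw [lookups]
    refine Yields.mono (K := 1 + (1 + (4 * es.length + 2)))
      ((yields_op e).bind ((yields_op _).bind (ih.bind ?_))) (by simp; omega)
    by_cases h : Incident u e
    · simp only [h, decide_true, if_true, candLists, List.filter_cons, List.map_cons]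
      refine Yields.bind (a := (cand q g p u e).toList) (K := 1) (L := 1) (yields_op _) ?_
      exact yields_op _
    · simpa [h, candLists] using yields_pure _ _

theorem exists_yields_shortest (As : List (List V)) (best : List V) :
    ∃ B ∈ best :: As, (∀ A ∈ best :: As, B.length ≤ A.length) ∧
      Yields (shortest best As) B (3 * As.length) := by
  induction As generalizing best with
  | nil => exact ⟨best, by simp, by simp, yields_pure _ _⟩
  | cons A As ih =>
    obtain ⟨B, hB, hmin, hy⟩ := ih (if A.length < best.length then A else best)
    refine ⟨B, ?_, ?_, ?_⟩
    · split_ifs at hB <;> simp at hB ⊢ <;> tauto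
    · simp only [List.forall_mem_cons] at hmin ⊢
      refine ⟨?_, ?_, hmin.2⟩ <;> have := hmin.1 <;> split_ifs at this <;> omega
    · rw [shortest]
      refine Yields.mono (K := 1 + (1 + (1 + 3 * As.length)))
        ((yields_op _).bind ((yields_op _).bind ((yields_op _).bind ?_))) (by simp; omega)
      simpa using hy

theorem yields_inAll (v : V) (As : List (List V)) :
    Yields (inAll v As) (decide (∀ A ∈ As, v ∈ A)) As.length := by
  induction As with
  | nil => simpa [inAll] using yields_pure true 0
  | cons A As ih =>
    rw [inAll]
    refine Yields.mono (K := 1 + As.length) ((yields_op _).bind ?_) (by simp; omega)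
    by_cases h : v ∈ A
    · simpa [h] using ih
    · simpa [h] using yields_pure _ _

theorem yields_scan (As : List (List V)) (B : List V) :
    Yields (scan As B) (B.filter fun v => decide (∀ A ∈ As, v ∈ A))
      ((As.length + 2) * B.length) := by
  induction B with
  | nil => exact yields_pure _ _
  | cons v vs ih =>
    rw [scan]
    refine Yields.mono (K := 1 + (As.length + ((As.length + 2) * vs.length + 1)))
      ((yields_op _).bind ((yields_inAll v As).bind (ih.bind ?_))) (by simp; ring_nf; omega)
    by_cases h : ∀ A ∈ As, v ∈ A
    · rw [if_pos (decide_eq_true h), List.filter_cons_of_pos (by simpa using h)]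
      exact yields_op _
    · simpa [h] using yields_pure _ _

/-- Here `k` is the length of the scanned set, the quantity to be charged to the potential. An
incident edge is needed: without one, the program returns the empty array while the sample space is
all of `V`. -/
theorem exists_yields_intersect [Fintype V] (q : LGraph VQ LV LE) (g : LGraph V LV LE)
    (p : VQ → Option V) (u : VQ) (hu : ∃ e ∈ q.edges, Incident u e) :
    ∃ (P : List V) (k : ℕ), P.Nodup ∧ P.toFinset = sampleSpace q g p u ∧
      (∀ e ∈ q.edges, Incident u e → k ≤ (cand q g p u e).card) ∧
      Yields (intersect q g p u) P (7 * q.edges.card + (q.edges.card + 2) * k) := by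
  have hl := yields_lookups q g p u q.edges.toList
  have hlen : (candLists q g p u q.edges.toList).length ≤ q.edges.card := by
    simpa [candLists] using List.length_filter_le (fun e => decide (Incident u e)) q.edges.toList
  have hmem : ∀ A, A ∈ candLists q g p u q.edges.toList ↔
      ∃ e ∈ q.edges, Incident u e ∧ (cand q g p u e).toList = A := by
    simp [candLists, and_assoc]
  rw [Finset.length_toList] at hl
  obtain ⟨e₀, he₀, hi₀⟩ := hu
  cases hA : candLists q g p u q.edges.toList with
  | nil =>
    have := (hmem _).2 ⟨e₀, he₀, hi₀, rfl⟩
    simp [hA] at this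
  | cons A As =>
    rw [hA] at hl hlen hmem
    obtain ⟨B, hB, hmin, hy⟩ := exists_yields_shortest As A
    refine ⟨_, B.length, ?_, ?_, ?_, ((hl.bind (hy.bind (yields_scan (A :: As) B))).mono ?_)⟩
    · obtain ⟨e, -, -, rfl⟩ := (hmem B).1 hB
      exact (Finset.nodup_toList _).filter _
    · ext v
      simp only [List.mem_toFinset, List.mem_filter, decide_eq_true_eq, sampleSpace,
        Finset.mem_filter, Finset.mem_univ, true_and]
      constructor
      · rintro ⟨-, h⟩ e he hi
        exact Finset.mem_toList.1 (h _ ((hmem _).2 ⟨e, he, hi, rfl⟩))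
      · intro h
        have h' : ∀ A' ∈ A :: As, v ∈ A' := by
          intro A' hA'
          obtain ⟨e, he, hi, rfl⟩ := (hmem A').1 hA'
          exact Finset.mem_toList.2 (h e he hi)
        exact ⟨h' B hB, h'⟩
    · intro e he hi
      simpa using hmin _ ((hmem _).2 ⟨e, he, hi, rfl⟩)
    -- Per query edge, 4 steps for the lookups and 3 for finding a shortest set make the 7; each
    -- scanned entry costs at most one test per set and two further steps.
    · simp only [List.length_cons] at hlen ⊢
      have : (As.length + 1 + 2) * B.length ≤ (q.edges.card + 2) * B.length :=
        Nat.mul_le_mul_right _ (by omega)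
      omega

/-! ### Drawing without replacement -/

/-- Order is lost, but `drawSum` sees only the set of remaining entries. If `i` is the last index,
the overwriting changes nothing and the shortening removes the drawn entry. -/
theorem cons_dropLast_set_perm (l : List α) (hl : l ≠ []) (i : ℕ) (hi : i < l.length) :
    (l[i] :: (l.set i (l.getLast hl)).dropLast).Perm l := by
  refine (List.Perm.cons _ ?_).trans (List.getElem_cons_eraseIdx_perm hi)
  induction l using List.reverseRecOn with
  | nil => exact absurd rfl hl
  | append_singleton L a _ =>
    rcases lt_or_ge i L.length with h | h
    · rw [List.set_append_left _ _ h, List.dropLast_concat, List.getLast_append_singleton,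
        List.eraseIdx_append_of_lt_length h]
      exact (List.set_perm_cons_eraseIdx h a).trans (List.perm_append_singleton _ _).symm
    · have : i = L.length := by simp at hi; omega
      subst this
      simp [List.eraseIdx_append_of_length_le]

theorem uniformOfFinset_toFinset (v : V) (vs : List V) (hnd : (v :: vs).Nodup)
    (h : (v :: vs).toFinset.Nonempty) :
    PMF.uniformOfFinset (v :: vs).toFinset h =
      (PMF.uniformOfFintype (Fin (vs.length + 1))).map (v :: vs).get := by
  ext a
  rw [PMF.map_apply, tsum_fintype, PMF.uniformOfFinset_apply]
  change _ = ∑ i : Fin (vs.length + 1),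
    if a = (v :: vs).get i then PMF.uniformOfFintype (Fin (vs.length + 1)) i else 0
  simp only [PMF.uniformOfFintype_apply]
  split_ifs with ha
  · obtain ⟨i, rfl⟩ := List.get_of_mem (List.mem_toFinset.1 ha)
    refine Eq.symm ((Finset.sum_eq_single (M := ENNReal) (show Fin (vs.length + 1) from i)
      ?_ ?_).trans ?_)
    · intro j _ hj
      exact if_neg fun e => hj (hnd.get_inj_iff.1 e).symm
    · exact fun h => absurd (Finset.mem_univ _) h
    · rw [List.toFinset_card_of_nodup hnd]
      simp
  · symm
    apply Finset.sum_eq_zero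
    intro i _
    rw [if_neg]
    rintro rfl
    exact ha (List.mem_toFinset.2 (List.get_mem _ _))

/-- The budget runs over the whole pool, not over `t` draws: no entry is drawn twice, so it covers
every `t` and every outcome. The 8 counts the elementary operations of one iteration besides the
call. -/
theorem performs_sampleLoop (walk : V → Timed ℝ) (Y : V → PMF ℝ) (f : V → ℝ) (hf : ∀ v, 0 ≤ f v)
    (t : ℕ) (pool : List V) (w : ℝ) (hnd : pool.Nodup)
    (hw : ∀ v ∈ pool, Performs (walk v) (Y v) (f v)) :
    Performs (sampleLoop walk t pool w) ((drawSum Y t pool.toFinset).map fun s => w + s)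
      (pool.map fun v => f v + 8).sum := by
  induction t generalizing pool w with
  | zero =>
    rw [sampleLoop, drawSum, PMF.pure_map, add_zero]
    refine (yields_pure w 0).performs.mono ?_
    rw [Nat.cast_zero]
    exact List.sum_nonneg (by simpa using fun v _ => by linarith [hf v])
  | succ t ih =>
    cases pool with
    | nil =>
      rw [sampleLoop]
      simpa [drawSum, PMF.pure_map] using (yields_pure w 0).performs
    | cons v vs =>
      have hne : (v :: vs).toFinset.Nonempty := ⟨v, by simp⟩
      rw [sampleLoop, drawSum, dif_pos hne, uniformOfFinset_toFinset v vs hnd, PMF.bind_map,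
        PMF.map_bind]
      set S := ((v :: vs).map fun v => f v + 8).sum with hS
      -- The budget left after the draw may not depend on the index `i`; it does not, because `S` is
      -- invariant under moving the drawn entry to the front.
      refine Performs.mono (K := 1 + (1 + (S - 2))) (Performs.op_bind
        ((performs_randIdx _).bind fun i => ?_)) (by linarith)
      have hp := cons_dropLast_set_perm (v :: vs) (List.cons_ne_nil v vs) i i.2
      set rest := ((v :: vs).set i ((v :: vs).getLast (List.cons_ne_nil v vs))).dropLast with hrest
      have hnd' := hp.nodup_iff.2 hnd
      have hsum : S = f ((v :: vs).get i) + 8 + (rest.map fun v => f v + 8).sum := by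
        rw [hS, ← (hp.map _).sum_eq]
        simp
      have hfin : (v :: vs).toFinset.erase ((v :: vs).get i) = rest.toFinset := by
        rw [← List.toFinset_eq_of_perm _ _ hp, List.toFinset_cons, List.get_eq_getElem,
          Finset.erase_insert]
        simpa using (List.nodup_cons.1 hnd').1
      simp only [Function.comp_apply, PMF.map_bind, hfin]
      refine Performs.mono (K := 1 + (1 + (1 + (1 + (f ((v :: vs).get i) + (1 + (1 +
        (rest.map fun v => f v + 8).sum))))))) (Performs.op_bind (Performs.op_bind
          (Performs.op_bind (Performs.op_bind ((hw _ (List.get_mem _ _)).bind fun y =>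
            Performs.op_bind (Performs.op_bind ?_)))))) (by linarith)
      rw [PMF.map_comp]
      have := ih rest (w + y) (List.nodup_cons.1 hnd').2 fun a ha =>
        hw a (hp.subset (List.mem_cons_of_mem _ ha))
      convert this using 3
      simp [add_assoc]

/-! ### The potential of a partial mapping -/

/-- The data edges that match `e` and agree with the partial mapping `p`. -/
def slice (q : LGraph VQ LV LE) (g : LGraph V LV LE) (p : VQ → Option V) (e : VQ × VQ) :
    Finset (V × V) :=
  (rel q g e).filter fun d =>
    (∀ v, p e.1 = some v → d.1 = v) ∧ (∀ v, p e.2 = some v → d.2 = v)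

/-- The number of data edges that match `e` and agree with `p`, but at least one. -/
def sliceSize (q : LGraph VQ LV LE) (g : LGraph V LV LE) (p : VQ → Option V) (e : VQ × VQ) : ℝ :=
  max 1 ((slice q g p e).card : ℝ)

/-- The product bound for the extensions of the partial mapping `p`. -/
def potential (q : LGraph VQ LV LE) (g : LGraph V LV LE) (x : VQ × VQ → ℝ) (p : VQ → Option V) :
    ℝ :=
  ∏ e ∈ q.edges, sliceSize q g p e ^ x e

theorem one_le_sliceSize (q : LGraph VQ LV LE) (g : LGraph V LV LE) (p : VQ → Option V)
    (e : VQ × VQ) : 1 ≤ sliceSize q g p e :=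
  le_max_left _ _

theorem slice_update_of_not_incident (q : LGraph VQ LV LE) (g : LGraph V LV LE)
    (p : VQ → Option V) {u : VQ} {e : VQ × VQ} (h : ¬ Incident u e) (a : Option V) :
    slice q g (Function.update p u a) e = slice q g p e := by
  simp only [Incident, not_or] at h
  rw [slice, slice, Function.update_of_ne (Ne.symm h.1), Function.update_of_ne (Ne.symm h.2)]

theorem slice_update_subset (q : LGraph VQ LV LE) (g : LGraph V LV LE) {p : VQ → Option V}
    {u : VQ} (hp : p u = none) (e : VQ × VQ) (a : Option V) :
    slice q g (Function.update p u a) e ⊆ slice q g p e := by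
  intro d hd
  simp only [slice, Finset.mem_filter] at hd ⊢
  refine ⟨hd.1, fun v hv => hd.2.1 v ?_, fun v hv => hd.2.2 v ?_⟩
  · rwa [Function.update_of_ne]
    intro h
    simp [h, hp] at hv
  · rwa [Function.update_of_ne]
    intro h
    simp [h, hp] at hv

/-- The data edge that puts `v` into the candidate set survives the extension. Hence the maximum
with 1 in `sliceSize` is inactive on the sample space. -/
theorem slice_update_nonempty {q : LGraph VQ LV LE} {g : LGraph V LV LE} {p : VQ → Option V}
    {u : VQ} {e : VQ × VQ} {v : V} (hv : v ∈ cand q g p u e) :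
    (slice q g (Function.update p u (some v)) e).Nonempty := by
  obtain ⟨d, hd, rfl⟩ := Finset.mem_image.1 hv
  refine ⟨d, ?_⟩
  simp only [slice, rel, Finset.mem_filter] at hd ⊢
  refine ⟨hd.1, fun v hv => ?_, fun v hv => ?_⟩
  · by_cases h1 : u = e.1
    · rw [h1] at hv
      simpa using hv
    · rw [Function.update_of_ne (Ne.symm h1)] at hv
      exact hd.2.1 v hv
  · by_cases h2 : u = e.2
    · rw [h2] at hv
      simp only [Function.update_self, Option.some.injEq] at hv
      -- For a query loop both endpoints become fixed at once; matching edges are then loops too.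
      by_cases h12 : e.1 = e.2
      · rw [if_pos h12.symm] at hv
        rw [← hv, hd.1.2.2.2.2 h12]
      · rwa [if_neg (Ne.symm h12)] at hv
    · rw [Function.update_of_ne (Ne.symm h2)] at hv
      exact hd.2.2 v hv

/-- The value at `u` can be read off a data edge in the slice, so slices for different values are
disjoint parts of the old one. -/
theorem sum_card_slice_update_le (q : LGraph VQ LV LE) (g : LGraph V LV LE) {p : VQ → Option V}
    {u : VQ} (hp : p u = none) {e : VQ × VQ} (h : Incident u e) (P : Finset V) :
    ∑ v ∈ P, (slice q g (Function.update p u (some v)) e).card ≤ (slice q g p e).card := by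
  rw [← Finset.card_biUnion]
  · exact Finset.card_le_card (Finset.biUnion_subset.2 fun v _ => slice_update_subset q g hp e _)
  · intro v _ w _ hvw
    refine Finset.disjoint_left.2 fun d hd hd' => hvw ?_
    simp only [slice, Finset.mem_filter] at hd hd'
    rcases h with rfl | rfl
    · rw [← hd.2.1 v (by simp), ← hd'.2.1 w (by simp)]
    · rw [← hd.2.2 v (by simp), ← hd'.2.2 w (by simp)]

/-- Hölder's inequality for finitely many functions with exponents of sum at least one. -/
theorem sum_prod_rpow_le_prod_rpow {ι κ : Type} (s : Finset ι) (A : Finset κ) (x : ι → ℝ)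
    (hx : ∀ i ∈ s, 0 ≤ x i) (hs : 1 ≤ ∑ i ∈ s, x i) (f : ι → κ → ℝ) (F : ι → ℝ)
    (hf : ∀ i ∈ s, ∀ a ∈ A, 0 ≤ f i a) (hF : ∀ i ∈ s, 0 < F i)
    (hfF : ∀ i ∈ s, ∑ a ∈ A, f i a ≤ F i) :
    ∑ a ∈ A, ∏ i ∈ s, f i a ^ x i ≤ ∏ i ∈ s, F i ^ x i := by
  set σ := ∑ i ∈ s, x i with hσ
  have hσ0 : 0 < σ := by linarith
  have hpos : 0 < ∏ i ∈ s, F i ^ x i := Finset.prod_pos fun i hi => Real.rpow_pos_of_pos (hF i hi) _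
  have key : ∀ a ∈ A, ∏ i ∈ s, f i a ^ x i ≤
      (∏ i ∈ s, F i ^ x i) * ∑ i ∈ s, x i / σ * (f i a / F i) := by
    intro a ha
    have hr0 : ∀ i ∈ s, 0 ≤ f i a / F i := fun i hi => div_nonneg (hf i hi a ha) (hF i hi).le
    have hr1 : ∀ i ∈ s, f i a / F i ≤ 1 := fun i hi => by
      rw [div_le_one (hF i hi)]
      exact (Finset.single_le_sum (f := f i) (hf i hi) ha).trans (hfF i hi)
    have e : ∏ i ∈ s, f i a ^ x i = (∏ i ∈ s, F i ^ x i) * ∏ i ∈ s, (f i a / F i) ^ x i := by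
      rw [← Finset.prod_mul_distrib]
      refine Finset.prod_congr rfl fun i hi => ?_
      rw [← Real.mul_rpow (hF i hi).le (hr0 i hi), mul_div_cancel₀ _ (hF i hi).ne']
    rw [e]
    refine mul_le_mul_of_nonneg_left ?_ hpos.le
    calc ∏ i ∈ s, (f i a / F i) ^ x i ≤ ∏ i ∈ s, (f i a / F i) ^ (x i / σ) := by
          refine Finset.prod_le_prod (fun i hi => Real.rpow_nonneg (hr0 i hi) _) fun i hi => ?_
          have hxs : x i / σ ≤ x i := div_le_self (hx i hi) hs
          exact Real.rpow_le_rpow_of_exponent_ge' (hr0 i hi) (hr1 i hi)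
            (div_nonneg (hx i hi) hσ0.le) hxs
      _ ≤ ∑ i ∈ s, x i / σ * (f i a / F i) := by
          refine Real.geom_mean_le_arith_mean_weighted s _ _
            (fun i hi => div_nonneg (hx i hi) hσ0.le) ?_ hr0
          rw [← Finset.sum_div, ← hσ, div_self hσ0.ne']
  calc ∑ a ∈ A, ∏ i ∈ s, f i a ^ x i
      ≤ ∑ a ∈ A, (∏ i ∈ s, F i ^ x i) * ∑ i ∈ s, x i / σ * (f i a / F i) :=
        Finset.sum_le_sum key
    _ = (∏ i ∈ s, F i ^ x i) * ∑ i ∈ s, x i / σ * ((∑ a ∈ A, f i a) / F i) := by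
        rw [← Finset.mul_sum, Finset.sum_comm]
        simp only [← Finset.mul_sum, Finset.sum_div]
    _ ≤ (∏ i ∈ s, F i ^ x i) * ∑ i ∈ s, x i / σ := by
        refine mul_le_mul_of_nonneg_left (Finset.sum_le_sum fun i hi => ?_) hpos.le
        refine mul_le_of_le_one_right (div_nonneg (hx i hi) hσ0.le) ?_
        exact (div_le_one (hF i hi)).2 (hfF i hi)
    _ = ∏ i ∈ s, F i ^ x i := by
        rw [← Finset.sum_div, ← hσ, div_self hσ0.ne', mul_one]

theorem one_le_rpow_sliceSize {q : LGraph VQ LV LE} {x : VQ × VQ → ℝ} (hx : IsFracEdgeCover q x)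
    (g : LGraph V LV LE) (p : VQ → Option V) {e : VQ × VQ} (he : e ∈ q.edges) :
    1 ≤ sliceSize q g p e ^ x e :=
  Real.one_le_rpow (one_le_sliceSize q g p e) (hx.1 e he)

theorem potential_eq_mul (q : LGraph VQ LV LE) (g : LGraph V LV LE) (x : VQ × VQ → ℝ)
    (p : VQ → Option V) (u : VQ) :
    potential q g x p =
      (∏ e ∈ q.edges.filter (Incident u), sliceSize q g p e ^ x e) *
        ∏ e ∈ q.edges.filter fun e => ¬ Incident u e, sliceSize q g p e ^ x e :=
  (Finset.prod_filter_mul_prod_filter_not _ _ _).symm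

theorem one_le_potential {q : LGraph VQ LV LE} {x : VQ × VQ → ℝ} (hx : IsFracEdgeCover q x)
    (g : LGraph V LV LE) (p : VQ → Option V) : 1 ≤ potential q g x p :=
  Finset.one_le_prod fun _ he => one_le_rpow_sliceSize hx g p he

/-- Edges away from `u` keep their factors. For the edges at `u` the exponents sum to at least one,
so Hölder reduces the claim to the disjointness of the slices. -/
theorem sum_potential_le {q : LGraph VQ LV LE} {x : VQ × VQ → ℝ} (hx : IsFracEdgeCover q x)
    (g : LGraph V LV LE) [Fintype V] {p : VQ → Option V} {u : VQ} (hp : p u = none) :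
    ∑ v ∈ sampleSpace q g p u, potential q g x (Function.update p u (some v)) ≤
      potential q g x p := by
  simp only [potential_eq_mul q g x _ u]
  have hrest : ∀ v, ∏ e ∈ q.edges.filter (fun e => ¬ Incident u e),
      sliceSize q g (Function.update p u (some v)) e ^ x e =
      ∏ e ∈ q.edges.filter (fun e => ¬ Incident u e), sliceSize q g p e ^ x e := fun v =>
    Finset.prod_congr rfl fun e he => by
      rw [sliceSize, slice_update_of_not_incident q g p (Finset.mem_filter.1 he).2, sliceSize]
  simp only [hrest]
  rw [← Finset.sum_mul]
  refine mul_le_mul_of_nonneg_right ?_ (Finset.prod_nonneg fun e he =>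
    zero_le_one.trans (one_le_rpow_sliceSize hx g p (Finset.mem_filter.1 he).1))
  refine sum_prod_rpow_le_prod_rpow _ _ x (fun e he => hx.1 e (Finset.mem_filter.1 he).1) (hx.2 u)
    (fun e v => sliceSize q g (Function.update p u (some v)) e) _
    (fun e _ v _ => zero_le_one.trans (one_le_sliceSize _ _ _ _))
    (fun e _ => zero_lt_one.trans_le (one_le_sliceSize _ _ _ _)) fun e he => ?_
  obtain ⟨he, hi⟩ := Finset.mem_filter.1 he
  calc ∑ v ∈ sampleSpace q g p u, sliceSize q g (Function.update p u (some v)) e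
      = ∑ v ∈ sampleSpace q g p u, ((slice q g (Function.update p u (some v)) e).card : ℝ) := by
        refine Finset.sum_congr rfl fun v hv => max_eq_right ?_
        have := slice_update_nonempty ((Finset.mem_filter.1 hv).2 e he hi)
        exact_mod_cast this.card_pos
    _ ≤ ((slice q g p e).card : ℝ) := by
        exact_mod_cast sum_card_slice_update_le q g hp hi _
    _ ≤ sliceSize q g p e := le_max_right _ _

/-- Each candidate set is an image of a slice, so every factor at `u` is at least max(1, k)^(x e),
and these exponents sum to at least one. -/
theorem le_potential {q : LGraph VQ LV LE} {x : VQ × VQ → ℝ} (hx : IsFracEdgeCover q x)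
    (g : LGraph V LV LE) (p : VQ → Option V) (u : VQ) {k : ℕ}
    (hk : ∀ e ∈ q.edges, Incident u e → k ≤ (cand q g p u e).card) :
    (k : ℝ) ≤ potential q g x p := by
  have h1 : (1 : ℝ) ≤ max 1 (k : ℝ) := le_max_left _ _
  have h0 : (0 : ℝ) < max 1 (k : ℝ) := by linarith
  calc (k : ℝ) ≤ max 1 (k : ℝ) := le_max_right _ _
    _ ≤ max 1 (k : ℝ) ^ ∑ e ∈ q.edges.filter (Incident u), x e :=
        Real.self_le_rpow_of_one_le h1 (hx.2 u)
    _ = ∏ e ∈ q.edges.filter (Incident u), max 1 (k : ℝ) ^ x e := Real.rpow_sum_of_pos h0 _ _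
    _ ≤ ∏ e ∈ q.edges.filter (Incident u), sliceSize q g p e ^ x e := by
        refine Finset.prod_le_prod (fun e _ => Real.rpow_nonneg h0.le _) fun e he => ?_
        obtain ⟨he, hi⟩ := Finset.mem_filter.1 he
        refine Real.rpow_le_rpow h0.le (max_le_max le_rfl ?_) (hx.1 e he)
        exact_mod_cast (hk e he hi).trans Finset.card_image_le
    _ ≤ potential q g x p := by
        rw [potential_eq_mul q g x p u]
        exact le_mul_of_one_le_right
          (Finset.prod_nonneg fun e he =>
            zero_le_one.trans (one_le_rpow_sliceSize hx g p (Finset.mem_filter.1 he).1))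
          (Finset.one_le_prod fun e he =>
            one_le_rpow_sliceSize hx g p (Finset.mem_filter.1 he).1)

theorem potential_none_le {q : LGraph VQ LV LE} {x : VQ × VQ → ℝ} (hx : IsFracEdgeCover q x)
    (g : LGraph V LV LE) (N : VQ × VQ → ℕ)
    (hN : ∀ e ∈ q.edges, 1 ≤ N e ∧ (rel q g e).card ≤ N e) :
    potential q g x (fun _ => none) ≤ ∏ e ∈ q.edges, (N e : ℝ) ^ x e := by
  refine Finset.prod_le_prod
    (fun e he => zero_le_one.trans (one_le_rpow_sliceSize hx g _ he)) fun e he => ?_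
  refine Real.rpow_le_rpow (zero_le_one.trans (one_le_sliceSize _ _ _ _)) (max_le ?_ ?_)
    (hx.1 e he)
  · exact_mod_cast (hN e he).1
  · exact_mod_cast (Finset.card_le_card (Finset.filter_subset _ _)).trans (hN e he).2

/-! ### The random walk -/

/-- Each level adds at most `8 * q.edges.card + 20` times the potential: intersection, loop overhead
and constants are all absorbed because the potential is at least 1. The extra 1 in `us.length + 1`
pays for the empty list. -/
theorem performs_walk [Fintype V] {q : LGraph VQ LV LE} {x : VQ × VQ → ℝ}
    (hx : IsFracEdgeCover q x) (g : LGraph V LV LE) (b : ℝ)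
    (hq : ∀ u : VQ, ∃ e ∈ q.edges, Incident u e) (us : List VQ) (p : VQ → Option V)
    (hnd : us.Nodup) (hp : ∀ u ∈ us, p u = none) :
    Performs (walk b q g us p) (lawY b q g us p)
      ((8 * q.edges.card + 20) * (us.length + 1) * potential q g x p) := by
  have hm : (0 : ℝ) ≤ q.edges.card := Nat.cast_nonneg _
  induction us generalizing p with
  | nil =>
    rw [walk, lawY]
    refine (performs_op (1 : ℝ)).mono ?_
    have := one_le_potential hx g p
    simp only [List.length_nil, Nat.cast_zero]
    nlinarith
  | cons u us ih =>
    obtain ⟨P, k, hPnd, hP, hk, hy⟩ := exists_yields_intersect q g p u (hq u)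
    have hkW := le_potential hx g p u hk
    have hW1 := one_le_potential hx g p
    have hmk := mul_le_mul_of_nonneg_left hkW (by linarith : (0 : ℝ) ≤ q.edges.card + 2)
    have hmW := mul_le_mul_of_nonneg_left hW1 hm
    have hcard : P.length = (sampleSpace q g p u).card := by
      rw [← hP, List.toFinset_card_of_nodup hPnd]
    cases us with
    | nil =>
      rw [walk, lawY, ← hcard]
      refine Performs.mono (Performs.op_bind (hy.bind_performs
        (Performs.op_bind (performs_op _)))) ?_
      push_cast
      simp only [List.length_nil, List.length_cons]
      nlinarith
    | cons u' us =>
      obtain ⟨hu, hnd'⟩ := List.nodup_cons.1 hnd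
      set K : ℝ := (8 * q.edges.card + 20) * ((u' :: us).length + 1) with hK
      have hK0 : 0 ≤ K := by positivity
      have hKe : ((8 * q.edges.card + 20) * (((u :: u' :: us).length : ℕ) + 1) : ℝ) =
          8 * q.edges.card + 20 + K := by
        rw [hK]
        push_cast [List.length_cons]
        ring
      rw [hKe]
      have hW0 : ∀ p' : VQ → Option V, 0 ≤ potential q g x p' := fun p' =>
        zero_le_one.trans (one_le_potential hx g p')
      have hloop := performs_sampleLoop
        (fun v => do
          let p' ← op (Function.update p u (some v))
          walk b q g (u' :: us) p')
        (fun v => lawY b q g (u' :: us) (Function.update p u (some v)))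
        (fun v => 1 + K * potential q g x (Function.update p u (some v)))
        (fun v => by have := mul_nonneg hK0 (hW0 (Function.update p u (some v))); linarith)
        (branchSize b P.length) P 0 hPnd
        (fun v _ => Performs.op_bind (ih _ hnd' fun w hw => by
          rw [Function.update_of_ne (ne_of_mem_of_not_mem hw hu)]
          exact hp w (List.mem_cons_of_mem _ hw)))
      -- Per entry, 1 for extending the mapping and 8 for the loop; these 9 steps are charged to the
      -- potential of the extension.
      have hsum : (P.map fun v => 1 + K * potential q g x (Function.update p u (some v)) + 8).sum ≤
          (9 + K) * potential q g x p := by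
        rw [← List.sum_toFinset _ hPnd, hP]
        refine le_trans (Finset.sum_le_sum (g := fun v =>
          (9 + K) * potential q g x (Function.update p u (some v))) fun v _ => ?_) ?_
        · have := one_le_potential hx g (Function.update p u (some v))
          linarith
        · rw [← Finset.mul_sum]
          exact mul_le_mul_of_nonneg_left
            (sum_potential_le hx g (hp u List.mem_cons_self)) (by linarith)
      rw [hP] at hloop
      replace hloop := hloop.mono hsum
      simp only [zero_add] at hloop
      set D := drawSum (fun v => lawY b q g (u' :: us) (Function.update p u (some v)))
        (branchSize b P.length) (sampleSpace q g p u) with hD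
      rw [show D.map (fun s => s) = D from PMF.map_id D] at hloop
      have hlaw : lawY b q g (u :: u' :: us) p = D.bind fun s =>
          PMF.pure ((P.length : ℝ) * (1 / (branchSize b P.length : ℝ)) * s) := by
        rw [lawY, hD, hcard]
        exact (PMF.bind_pure_comp _ _).symm
      have hKW := mul_nonneg hK0 (hW0 p)
      rw [walk, hlaw]
      refine Performs.mono (K := 1 + (((7 * q.edges.card + (q.edges.card + 2) * k : ℕ) : ℝ) +
        (1 + (1 + (5 + (9 + K) * potential q g x p)))))
        (Performs.op_bind (hy.bind_performs (Performs.op_bind (Performs.op_bind ?_)))) ?_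
      -- With an empty sample space the program exits early, in agreement with the law: the
      -- prefactor `P.length` vanishes.
      · by_cases h0 : P.length = 0
        · have hzero : (D.bind fun s =>
              PMF.pure ((P.length : ℝ) * (1 / (branchSize b P.length : ℝ)) * s)) =
              PMF.pure 0 := by
            simp [h0]
          rw [hzero, if_pos (decide_eq_true h0)]
          exact (performs_op (0 : ℝ)).mono (by linarith [hW0 p])
        · rw [if_neg (by simpa using h0)]
          refine Performs.mono (K := 1 + (1 + ((9 + K) * potential q g x p + (1 + (1 + 1)))))
            (Performs.op_bind (Performs.op_bind ?_)) (by linarith)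
          refine Performs.bind hloop fun w => ?_
          exact Performs.op_bind (Performs.op_bind (performs_op _))
      · push_cast
        linarith

theorem yields_foldlM_update (o : List VQ) :
    Yields (o.foldlM (fun (p : VQ → Option V) u => op (Function.update p u none)) fun _ => none)
      (fun _ => none) o.length := by
  induction o with
  | nil => exact yields_pure _ _
  | cons u us ih =>
    rw [List.foldlM_cons]
    refine Yields.mono (K := 1 + us.length) ((yields_op _).bind ?_) (by simp; omega)
    have : Function.update (fun _ : VQ => (none : Option V)) u none = fun _ => none :=
      Function.update_eq_self u _
    rwa [this]

theorem performs_run [Fintype V] {q : LGraph VQ LV LE} {x : VQ × VQ → ℝ}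
    (hx : IsFracEdgeCover q x) (g : LGraph V LV LE) (b : ℝ)
    (hq : ∀ u : VQ, ∃ e ∈ q.edges, Incident u e) (o : List VQ) (ho : o.Nodup) :
    Performs (run b q g o) (lawY₁ b q g o)
      (o.length + (8 * q.edges.card + 20) * (o.length + 1) *
        potential q g x fun _ => none) :=
  (yields_foldlM_update o).bind_performs (performs_walk hx g b hq o _ ho fun _ _ => rfl)

/-- Makes the set under the infimum in `agm` nonempty, as a lower bound on a real `sInf` requires.
-/
theorem isFracEdgeCover_one [Fintype VQ] (q : LGraph VQ LV LE)
    (hq : ∀ u : VQ, ∃ e ∈ q.edges, Incident u e) : IsFracEdgeCover q fun _ => 1 := by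
  refine ⟨fun _ _ => zero_le_one, fun u => ?_⟩
  obtain ⟨e, he, hi⟩ := hq u
  have : 0 < (q.edges.filter (Incident u)).card :=
    Finset.card_pos.2 ⟨e, Finset.mem_filter.2 ⟨he, hi⟩⟩
  rw [Finset.sum_const, nsmul_eq_mul, mul_one]
  exact_mod_cast this

end Alley

end

theorem proposition3 (n : ℕ) :
    ∃ C : ℝ, ∀ (VQ V LV LE : Type) [Fintype VQ] [Fintype V]
      (q : Alley.LGraph VQ LV LE) (g : Alley.LGraph V LV LE)
      (o : List VQ) (b : ℝ) (N : VQ × VQ → ℕ),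
      Fintype.card VQ = n →
      (∀ u : VQ, ∃ e ∈ q.edges, Alley.Incident u e) →
      o.Nodup → (∀ u : VQ, u ∈ o) →
      0 < b → b ≤ 1 →
      (∀ e ∈ q.edges, 1 ≤ N e ∧ (Alley.rel q g e).card ≤ N e) →
      (Alley.run b q g o).law = Alley.lawY₁ b q g o ∧
      (Alley.run b q g o).StepsLE (C * Alley.agm q N) := by
  -- The first `n` pays for initializing the mapping; `n * n` bounds the number of query edges,
  -- which are distinct ordered pairs.
  set C : ℝ := n + (8 * (n * n) + 20) * (n + 1) with hC
  have hC0 : 0 < C := by positivity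
  refine ⟨C, fun VQ V LV LE _ _ q g o b N hn hq ho _ _ _ hN => ?_⟩
  have hcover := Alley.isFracEdgeCover_one q hq
  refine ⟨(Alley.performs_run hcover g b hq o ho).1, fun r hr => ?_⟩
  -- With `C` divided out, the step count of a single outcome is compared with every cover
  -- separately, so no minimizer is needed.
  rw [← div_le_iff₀' hC0]
  refine le_csInf ⟨_, _, hcover, rfl⟩ ?_
  rintro _ ⟨x, hx, rfl⟩
  rw [div_le_iff₀' hC0]
  have hlen : o.length ≤ n := hn ▸ ho.length_le_card
  have hm : q.edges.card ≤ n * n := by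
    simpa [hn] using Finset.card_le_univ q.edges
  have hlen' : (o.length : ℝ) ≤ n := by exact_mod_cast hlen
  have hm' : (q.edges.card : ℝ) ≤ n * n := by exact_mod_cast hm
  have hW := Alley.one_le_potential hx g fun _ => none
  calc (r.2 : ℝ) ≤ o.length + (8 * q.edges.card + 20) * (o.length + 1) *
        Alley.potential q g x fun _ => none := (Alley.performs_run hx g b hq o ho).2 r hr
    _ ≤ n * (Alley.potential q g x fun _ => none) + (8 * (n * n) + 20) * (n + 1) *
        Alley.potential q g x fun _ => none := by
      gcongr
      exact hlen'.trans (le_mul_of_one_le_right (Nat.cast_nonneg _) hW)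
    _ = C * Alley.potential q g x fun _ => none := by rw [hC]; ring
    _ ≤ C * ∏ e ∈ q.edges, (N e : ℝ) ^ x e :=
      mul_le_mul_of_nonneg_left (Alley.potential_none_le hx g N hN) hC0.le
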